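/- All groups are finite. A \emph{stem extension} of a group $G$ is a surjective homomorphism $\pi:E\to G$ with $\ker\pi\subseteq Z(E)\cap[E,E]$; a \emph{Schur cover} of $G$ is a stem extension of $G$ with $|E|$ as large as possible. Given a Schur cover $\pi:\tilde G\to G$, the \emph{deep commuting graph} $\Delta_D(G)$ is the simple graph with vertex set $G$ in which two distinct elements are adjacent if and only if their preimages under $\pi$ commute in $\tilde G$. For a graph $\Gamma$, the \emph{reduced graph} $\Gamma^*$ is the subgraph induced on the set of vertices that are not dominant, a vertex being dominant if it is adjacent to all other vertices. (1) Let $p$ be a prime and let $G$ be a finite non-cyclic abelian $p$-group. Then $G$ has a Schur cover, and $G\cong C_{p^{r_1}}\times\cdots\times C_{p^{r_k}}$ for some $k\ge 2$ and $r_1\ge r_2\ge\cdots\ge r_k\ge 1$. For every such decomposition and every choice of the Schur cover, $\Delta_D(G)^*$ is disconnected if and only if $r_2=1$. (2) Let $A$ be a finite non-cyclic abelian group. Then $A$ has a Schur cover, and for every choice of the Schur cover, $\Delta_D(A)^*$ is disconnected if and only if $A\cong C\times K$, where $C$ is a cyclic group and $K$ is an elementary abelian $p$-group for some prime $p$ (an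 abelian group all of whose non-identity elements have order $p$). -/

import Mathlib

/-- A surjection `π : E → G` is a stem extension of `G` if its kernel lies in `Z(E) ∩ E'`. -/
structure IsStemExtension {E G : Type*} [Group E] [Group G] (π : E →* G) : Prop where
  surjective : Function.Surjective π
  ker_le : π.ker ≤ Subgroup.center E ⊓ commutator E

/-- A Schur cover of `G` is a finite stem extension `π : E → G` of maximal order. The competing
finite stem extensions may be taken in `Type`, since every finite group is isomorphic to one
there. -/
structure IsSchurCover {E G : Type*} [Group E] [Group G] (π : E →* G) : Prop where
  finite : Finite E
  isStemExtension : IsStemExtension π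
  card_le : ∀ (H : Type) [Group H] [Finite H] (ρ : H →* G), IsStemExtension ρ →
    Nat.card H ≤ Nat.card E

/-- The deep commuting graph of `G`, computed in a Schur cover `π : E → G`: distinct elements of
`G` are adjacent when their preimages commute in `E`. -/
def deepCommutingGraph {E G : Type*} [Group E] [Group G] (π : E →* G) : SimpleGraph G where
  Adj x y := x ≠ y ∧ ∀ a b : E, π a = x → π b = y → Commute a b
  symm := ⟨fun _ _ h => ⟨h.1.symm, fun a b ha hb => (h.2 b a hb ha).symm⟩⟩
  loopless := ⟨fun _ h => h.1 rfl⟩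

/-- The reduced graph `Γ*`: the subgraph induced on the vertices that are not dominant
(`Γ.universalVerts` is the set of vertices adjacent to all other vertices). -/
def reducedGraph {V : Type*} (Γ : SimpleGraph V) : SimpleGraph ↥(Γ.universalVertsᶜ) :=
  Γ.induce Γ.universalVertsᶜ

/-- `G ≅ C_{p^{r₁}} × ⋯ × C_{p^{r_k}}` with `r₁ ≥ ⋯ ≥ r_k ≥ 1`. (Indices start at `0` in `Fin k`,
so `r₁` is `r 0` and `r₂` is `r 1`.) -/
structure HasPType (p : ℕ) (G : Type*) [Group G] {k : ℕ} (r : Fin k → ℕ) : Prop where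
  antitone : Antitone r
  pos : ∀ i, 1 ≤ r i
  iso : Nonempty (G ≃* ((i : Fin k) → Multiplicative (ZMod (p ^ r i))))

/-- An elementary abelian `p`-group: abelian, with all non-identity elements of order `p`. -/
def IsElementaryAbelian (p : ℕ) (K : Type*) [CommGroup K] : Prop :=
  ∀ x : K, x ≠ 1 → orderOf x = p

/-! In a stem extension `π : E → A` of an abelian group all commutators are central, so the
commutator is an alternating bilinear pairing that depends only on images in `A`. The dominant
vertices are the images of `Z(E)`, and the whole graph is governed by this pairing on `E / Z(E)`.

For a non-commutative Schur cover, the reduced graph is disconnected iff `E / Z(E)` has prime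
exponent (`IsSchurCover.not_connected_iff`). If the exponent is not prime, the powers of an element
of maximal order modulo the centre form a hub that every vertex reaches. If it is a prime `p`,
commuting is transitive on non-central elements, so a connected graph would make `E` commutative.

Transitivity needs the pairing to be as large as possible. Instead of computing the Schur
multiplier, `IsSchurCover.le_orderOf_commutatorElement` uses maximality directly: if a commutator
had smaller order than some alternating form predicts, a twisted product would yield a larger stem
extension. Applied to pairs of cyclic factors, the same bound turns prime exponent of `E / Z(E)`
into a condition on the decomposition of `A`; the converse is bilinearity. -/

open scoped commutatorElement

/-! ### Existence of Schur covers, by bounding stem extensions. -/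

section Existence

variable {E G : Type*} [Group E] [Group G]

theorem IsStemExtension.commutatorElement_eq {π : E →* G} (h : IsStemExtension π) {a b a' b' : E}
    (ha : π a = π a') (hb : π b = π b') : ⁅a, b⁆ = ⁅a', b'⁆ := by
  obtain ⟨z, hz, rfl⟩ : ∃ z ∈ Subgroup.center E, a = a' * z :=
    ⟨a'⁻¹ * a, (h.ker_le (by simp [MonoidHom.mem_ker, ha])).1, by group⟩
  obtain ⟨w, hw, rfl⟩ : ∃ z ∈ Subgroup.center E, b = b' * z :=
    ⟨b'⁻¹ * b, (h.ker_le (by simp [MonoidHom.mem_ker, hb])).1, by group⟩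
  have hz' := Subgroup.mem_center_iff.1 hz
  have hw' := Subgroup.mem_center_iff.1 hw
  simp only [commutatorElement_def, mul_inv_rev]
  calc a' * z * (b' * w) * (z⁻¹ * a'⁻¹) * (w⁻¹ * b'⁻¹)
      = a' * (z * (b' * w)) * z⁻¹ * a'⁻¹ * w⁻¹ * b'⁻¹ := by group
    _ = a' * b' * (w * a'⁻¹) * w⁻¹ * b'⁻¹ := by rw [← hz']; group
    _ = a' * b' * a'⁻¹ * b'⁻¹ := by rw [← hw']; group

/-- Being a stem extension only depends on the group up to isomorphism. -/
theorem IsStemExtension.comp_mulEquiv {F : Type*} [Group F] {π : E →* G} (h : IsStemExtension π)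
    (e : F ≃* E) : IsStemExtension (π.comp e.toMonoidHom) where
  surjective := h.surjective.comp e.surjective
  ker_le := by
    intro x hx
    have hx' : e x ∈ Subgroup.center E ⊓ commutator E := h.ker_le hx
    refine ⟨Subgroup.mem_center_iff.2 fun y => e.injective ?_, ?_⟩
    · simpa using Subgroup.mem_center_iff.1 hx'.1 (e y)
    · have := Subgroup.mem_map_of_mem e.symm.toMonoidHom hx'.2
      rw [commutator_def, Subgroup.map_commutator, ← MonoidHom.range_eq_map,
        MonoidHom.range_eq_top.2 e.symm.surjective, ← commutator_def] at this
      simpa using this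

/-- Maximality is only stated against `Type`, whereas the competitor built from `E` lives in the
universe of `E`. -/
theorem IsSchurCover.card_le_of_isStemExtension {π : E →* G} (h : IsSchurCover π) {H : Type*}
    [Group H] [Finite H] {ρ : H →* G} (hρ : IsStemExtension ρ) : Nat.card H ≤ Nat.card E := by
  obtain ⟨H', _, _, ⟨e⟩⟩ := Finite.exists_type_univ_nonempty_mulEquiv.{_, 0} H
  rw [Nat.card_congr e.toEquiv]
  exact h.card_le H' _ (hρ.comp_mulEquiv e.symm)

theorem IsStemExtension.card_commutatorSet_le [Finite G] {π : E →* G} (h : IsStemExtension π) :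
    Nat.card (commutatorSet E) ≤ Nat.card (G × G) := by
  let s := Function.surjInv h.surjective
  refine Nat.card_le_card_of_surjective
    (fun x : G × G => (⟨⁅s x.1, s x.2⁆, s x.1, s x.2, rfl⟩ : commutatorSet E)) ?_
  rintro ⟨_, a, b, rfl⟩
  refine ⟨(π a, π b), Subtype.ext ?_⟩
  exact h.commutatorElement_eq (Function.surjInv_eq _ _) (Function.surjInv_eq _ _)

/-- The order of a finite stem extension is bounded in terms of the order of the group. -/
theorem IsStemExtension.card_le [Finite E] [Finite G] {π : E →* G} (h : IsStemExtension π) :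
    Nat.card E ≤ (∑ n ∈ Finset.range (Nat.card (G × G) + 1), Subgroup.cardCommutatorBound n) *
      Nat.card G := by
  have h1 : Nat.card E = Nat.card π.ker * Nat.card G := by
    rw [← Subgroup.card_mul_index π.ker, Subgroup.index_ker, MonoidHom.range_eq_top.2 h.surjective,
      Subgroup.card_top]
  rw [h1]
  refine Nat.mul_le_mul_right _ ?_
  calc Nat.card π.ker ≤ Nat.card (commutator E) :=
        Nat.card_le_card_of_injective _
          (Subgroup.inclusion_injective (h.ker_le.trans inf_le_right))
    _ ≤ Subgroup.cardCommutatorBound (Nat.card (commutatorSet E)) :=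
        Subgroup.card_commutator_le_of_finite_commutatorSet E
    -- Summing over all admissible sizes avoids needing monotonicity of `cardCommutatorBound`.
    _ ≤ _ := Finset.single_le_sum (f := fun n => Subgroup.cardCommutatorBound n)
        (fun _ _ => Nat.zero_le _)
        (Finset.mem_range.2 (Nat.lt_succ_of_le h.card_commutatorSet_le))

/-- Every finite group has a Schur cover. -/
theorem exists_isSchurCover (G : Type*) [Group G] [Finite G] :
    ∃ (E : Type) (_ : Group E) (π : E →* G), IsSchurCover π := by
  classical
  let P : ℕ → Prop := fun n => ∃ (E : Type) (_ : Group E) (_ : Finite E) (π : E →* G),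
    IsStemExtension π ∧ Nat.card E = n
  have hid : IsStemExtension (MonoidHom.id G) :=
    ⟨Function.surjective_id, by
      intro x hx
      have : x = 1 := hx
      exact this ▸ one_mem _⟩
  obtain ⟨G', _, _, ⟨e⟩⟩ := Finite.exists_type_univ_nonempty_mulEquiv.{_, 0} G
  have hP : P (Nat.card G') := ⟨G', _, inferInstance, _, hid.comp_mulEquiv e.symm, rfl⟩
  let B := (∑ n ∈ Finset.range (Nat.card (G × G) + 1), Subgroup.cardCommutatorBound n) * Nat.card G
  have hB : ∀ n, P n → n ≤ B := by
    rintro n ⟨E, _, _, π, h, rfl⟩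
    exact h.card_le
  obtain ⟨E, _, hE, π, h, hn⟩ := Nat.findGreatest_spec (hB _ hP) hP
  refine ⟨E, _, π, hE, h, fun H _ _ ρ hρ => ?_⟩
  rw [hn]
  have hH : P (Nat.card H) := ⟨H, _, inferInstance, ρ, hρ, rfl⟩
  exact Nat.le_findGreatest (hB _ hH) hH

end Existence

/-! ### Central extensions by bilinear cocycles. -/

section TwistedProduct

variable {E R : Type*} [Group E] [CommRing R]

/-- The central extension of `E` by the additive group of `R` with the bilinear cocycle
`(a, b) ↦ f a * g b`. -/
@[ext]
structure TwistedProduct (f g : E →* Multiplicative R) where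
  fst : E
  snd : R

namespace TwistedProduct

variable {f g : E →* Multiplicative R}

instance : Mul (TwistedProduct f g) :=
  ⟨fun x y => ⟨x.fst * y.fst, x.snd + y.snd + (f x.fst).toAdd * (g y.fst).toAdd⟩⟩

instance : One (TwistedProduct f g) := ⟨⟨1, 0⟩⟩

instance : Inv (TwistedProduct f g) :=
  ⟨fun x => ⟨x.fst⁻¹, -x.snd + (f x.fst).toAdd * (g x.fst).toAdd⟩⟩

@[simp] theorem fst_mul (x y : TwistedProduct f g) : (x * y).fst = x.fst * y.fst := rfl

@[simp] theorem snd_mul (x y : TwistedProduct f g) :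
    (x * y).snd = x.snd + y.snd + (f x.fst).toAdd * (g y.fst).toAdd := rfl

@[simp] theorem fst_one : (1 : TwistedProduct f g).fst = 1 := rfl

@[simp] theorem snd_one : (1 : TwistedProduct f g).snd = 0 := rfl

@[simp] theorem fst_inv (x : TwistedProduct f g) : x⁻¹.fst = x.fst⁻¹ := rfl

@[simp] theorem snd_inv (x : TwistedProduct f g) :
    x⁻¹.snd = -x.snd + (f x.fst).toAdd * (g x.fst).toAdd := rfl

instance : Group (TwistedProduct f g) := Group.ofLeftAxioms
  (fun x y z => by ext <;> simp [mul_assoc]; ring)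
  (fun x => by ext <;> simp)
  (fun x => by ext <;> simp)

/-- The projection to the first factor. -/
def fstHom (f g : E →* Multiplicative R) : TwistedProduct f g →* E where
  toFun := fst
  map_one' := rfl
  map_mul' _ _ := rfl

@[simp] theorem fstHom_apply (x : TwistedProduct f g) : fstHom f g x = x.fst := rfl

theorem fstHom_surjective : Function.Surjective (fstHom f g) := fun a => ⟨⟨a, 0⟩, rfl⟩

/-- The underlying type is a product. -/
def equivProd (f g : E →* Multiplicative R) : TwistedProduct f g ≃ E × R where
  toFun x := (x.fst, x.snd)
  invFun x := ⟨x.1, x.2⟩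

/-- The second factor is a subgroup. -/
def inr (f g : E →* Multiplicative R) : Multiplicative R →* TwistedProduct f g where
  toFun t := ⟨1, t.toAdd⟩
  map_one' := rfl
  map_mul' _ _ := by ext <;> simp

theorem mk_pow {c : E} (hc : f c = 1) (n : ℕ) :
    (⟨c, 0⟩ : TwistedProduct f g) ^ n = ⟨c ^ n, 0⟩ := by
  induction n with
  | zero => simp; rfl
  | succ n ih => rw [pow_succ, ih]; ext <;> simp [hc, pow_succ]

theorem orderOf_mk {c : E} (hc : f c = 1) :
    orderOf (⟨c, 0⟩ : TwistedProduct f g) = orderOf c := by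
  refine orderOf_eq_orderOf_iff.2 fun n => ?_
  rw [mk_pow hc]
  constructor
  · intro h; exact congrArg fst h
  · intro h; ext <;> simp [h]

theorem mk_mem_center {c : E} (hc : c ∈ Subgroup.center E) (hf : f c = 1) (hg : g c = 1) (t : R) :
    (⟨c, t⟩ : TwistedProduct f g) ∈ Subgroup.center (TwistedProduct f g) := by
  refine Subgroup.mem_center_iff.2 fun x => ?_
  ext
  · exact Subgroup.mem_center_iff.1 hc x.fst
  · simp [hf, hg, add_comm]

/-- The second coordinate is the antisymmetrised cocycle: the alternating form which the cover will
be shown to detect. -/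
theorem commutatorElement_mk (a b : E) :
    ⁅(⟨a, 0⟩ : TwistedProduct f g), (⟨b, 0⟩ : TwistedProduct f g)⁆ =
      (⟨⁅a, b⁆, (f a).toAdd * (g b).toAdd - (f b).toAdd * (g a).toAdd⟩ : TwistedProduct f g) := by
  have hf : f ⁅a, b⁆ = 1 := by rw [map_commutatorElement]; simp [commutatorElement_def]
  have key : (⟨a, 0⟩ * ⟨b, 0⟩ : TwistedProduct f g) =
      ⟨⁅a, b⁆, (f a).toAdd * (g b).toAdd - (f b).toAdd * (g a).toAdd⟩ * (⟨b, 0⟩ * ⟨a, 0⟩) := by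
    ext
    · simp [commutatorElement_def]
    · simp [hf]
  rw [commutatorElement_def, key]
  group

end TwistedProduct

end TwistedProduct

/-! ### Lower bounds for orders of commutators, from maximality. -/

section Detection

variable {E A : Type*} [Group E] [CommGroup A] {π : E →* A}

theorem commutatorElement_mem_ker (π : E →* A) (a b : E) : ⁅a, b⁆ ∈ π.ker := by
  rw [MonoidHom.mem_ker, map_commutatorElement]
  simp [commutatorElement_def]

open TwistedProduct in
/-- A commutator in a Schur cover of an abelian group has at least the order that a cyclic
alternating form on the group prescribes. -/
theorem IsSchurCover.le_orderOf_commutatorElement (h : IsSchurCover π) {n : ℕ} [NeZero n]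
    (f g : A →* Multiplicative (ZMod n)) (a b : E)
    (hv : IsUnit ((f (π a)).toAdd * (g (π b)).toAdd - (f (π b)).toAdd * (g (π a)).toAdd)) :
    n ≤ orderOf ⁅a, b⁆ := by
  have := h.finite
  set v := (f (π a)).toAdd * (g (π b)).toAdd - (f (π b)).toAdd * (g (π a)).toAdd
  let X := TwistedProduct (f.comp π) (g.comp π)
  have hXfin : Finite X := Finite.of_equiv _ (equivProd _ _).symm
  have hker : ∀ c ∈ π.ker, c ∈ Subgroup.center E ∧ f (π c) = 1 ∧ g (π c) = 1 := fun c hc => by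
    have hc' : π c = 1 := hc
    exact ⟨(h.isStemExtension.ker_le hc).1, by simp [hc'], by simp [hc']⟩
  let ρ : X →* A := π.comp (fstHom _ _)
  have hρker : ρ.ker ≤ Subgroup.center X := by
    rintro ⟨c, t⟩ hc
    obtain ⟨h1, h2, h3⟩ := hker c hc
    exact mk_mem_center h1 h2 h3 t
  let l : X := ⟨⁅a, b⁆, 0⟩
  have hl : l ∈ ρ.ker := commutatorElement_mem_ker π a b
  have hlord : orderOf l = orderOf ⁅a, b⁆ :=
    orderOf_mk (hker _ (commutatorElement_mem_ker π a b)).2.1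
  -- `X` itself need not be stem over `A`. Killing `(⁅a, b⁆, 0)` makes the commutator `(⁅a, b⁆, v)`
  -- agree with `(1, v)`, and as `v` is a unit the whole factor `ZMod n` falls into the derived
  -- subgroup.
  let N : Subgroup X := Subgroup.zpowers l
  have hNker : N ≤ ρ.ker := by simpa [N] using hl
  have hNn : N.Normal := by
    refine ⟨fun x hx y => ?_⟩
    rw [Subgroup.mem_center_iff.1 (hρker (hNker hx)) y, mul_inv_cancel_right]
    exact hx
  have hinr : ∀ t : ZMod n, (⟨1, t⟩ : X) ∈ commutator X ⊔ N := by
    have h1 : (⟨1, v⟩ : X) ∈ commutator X ⊔ N := by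
      have hc : (⟨⁅a, b⁆, v⟩ : X) ∈ commutator X := by
        have := Subgroup.commutator_mem_commutator (Subgroup.mem_top (⟨a, 0⟩ : X))
          (Subgroup.mem_top (⟨b, 0⟩ : X))
        rwa [commutatorElement_mk] at this
      have : (⟨1, v⟩ : X) = ⟨⁅a, b⁆, v⟩ * l⁻¹ := by
        rw [eq_mul_inv_iff_mul_eq]
        ext <;> simp [l]
      rw [this]
      exact mul_mem (Subgroup.mem_sup_left hc)
        (inv_mem (Subgroup.mem_sup_right (Subgroup.mem_zpowers l)))
    intro t
    obtain ⟨u, hu⟩ := hv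
    have h2 : (⟨1, t⟩ : X) = ⟨1, v⟩ ^ (t * (u⁻¹ : (ZMod n)ˣ)).val := by
      change inr _ _ (Multiplicative.ofAdd t) = (inr _ _ (Multiplicative.ofAdd v)) ^ _
      rw [← map_pow, ← ofAdd_nsmul, nsmul_eq_mul, ZMod.natCast_zmod_val, ← hu]
      simp
    rw [h2]
    exact pow_mem h1 _
  have hsup : ρ.ker ≤ commutator X ⊔ N := by
    rintro ⟨c, t⟩ hc
    have hc2 : c ∈ commutator E := (h.isStemExtension.ker_le (show c ∈ π.ker from hc)).2
    have hmap : (commutator X).map (fstHom _ _) = commutator E := by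
      rw [commutator_def, Subgroup.map_commutator, ← MonoidHom.range_eq_map,
        MonoidHom.range_eq_top.2 fstHom_surjective, ← commutator_def]
    rw [← hmap] at hc2
    obtain ⟨⟨c', s⟩, hd, rfl⟩ := hc2
    have : (⟨c', t⟩ : X) = ⟨c', s⟩ * ⟨1, t - s⟩ := by ext <;> simp
    simp only [fstHom_apply] at *
    rw [this]
    exact mul_mem (Subgroup.mem_sup_left hd) (hinr _)
  have hstem : IsStemExtension (QuotientGroup.lift N ρ hNker) := by
    refine ⟨fun y => ?_, ?_⟩
    · obtain ⟨c, rfl⟩ := h.isStemExtension.surjective y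
      exact ⟨QuotientGroup.mk ⟨c, 0⟩, rfl⟩
    · intro x hx
      obtain ⟨x, rfl⟩ := QuotientGroup.mk_surjective x
      have hx' : x ∈ ρ.ker := hx
      refine ⟨Subgroup.mem_center_iff.2 fun y => ?_, ?_⟩
      · obtain ⟨y, rfl⟩ := QuotientGroup.mk_surjective y
        exact congrArg (QuotientGroup.mk (s := N)) (Subgroup.mem_center_iff.1 (hρker hx') y)
      · have h3 := Subgroup.mem_map_of_mem (QuotientGroup.mk' N) (hsup hx')
        rw [Subgroup.map_sup, QuotientGroup.map_mk'_self, sup_bot_eq, commutator_def,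
          Subgroup.map_commutator, ← MonoidHom.range_eq_map,
          MonoidHom.range_eq_top.2 (QuotientGroup.mk'_surjective N), ← commutator_def] at h3
        exact h3
  -- The new cover has order `|E| * n / orderOf ⁅a, b⁆`, which cannot exceed `|E|`.
  have hle := h.card_le_of_isStemExtension hstem
  have hcard : Nat.card X = Nat.card (X ⧸ N) * Nat.card N :=
    Subgroup.card_eq_card_quotient_mul_card_subgroup N
  rw [Nat.card_congr (equivProd _ _), Nat.card_prod, Nat.card_zmod, Nat.card_zpowers,
    hlord] at hcard
  have hpos : 0 < Nat.card E := Nat.card_pos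
  refine le_of_mul_le_mul_left (a := Nat.card E) ?_ hpos
  rw [hcard]
  exact Nat.mul_le_mul_right _ hle

/-- In a central extension of an abelian group, `a ↦ ⁅a, b⁆` is a homomorphism. -/
def commutatorHom (hπ : π.ker ≤ Subgroup.center E) (b : E) : E →* E where
  toFun a := ⁅a, b⁆
  map_one' := commutatorElement_one_left b
  map_mul' x y := by
    have h := Subgroup.mem_center_iff.1 (hπ (commutatorElement_mem_ker π y b))
    calc ⁅x * y, b⁆ = x * ⁅y, b⁆ * x⁻¹ * ⁅x, b⁆ := by simp only [commutatorElement_def]; group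
      _ = ⁅x, b⁆ * ⁅y, b⁆ := by rw [h x, mul_inv_cancel_right, h]

theorem commutatorElement_pow_left (hπ : π.ker ≤ Subgroup.center E) (a b : E) (n : ℕ) :
    ⁅a ^ n, b⁆ = ⁅a, b⁆ ^ n :=
  map_pow (commutatorHom hπ b) a n

theorem commutatorElement_pow_right (hπ : π.ker ≤ Subgroup.center E) (a b : E) (n : ℕ) :
    ⁅a, b ^ n⁆ = ⁅a, b⁆ ^ n := by
  rw [← inv_inj, commutatorElement_inv, commutatorElement_pow_left hπ, ← inv_pow,
    commutatorElement_inv]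

theorem IsStemExtension.ker_le_center (h : IsStemExtension π) : π.ker ≤ Subgroup.center E :=
  h.ker_le.trans inf_le_left

/-- A commutator in a Schur cover of an abelian group has order divisible by the order of a prime
power cyclic alternating form that takes a unit value on it. -/
theorem IsSchurCover.pow_dvd_orderOf_commutatorElement (h : IsSchurCover π) {q t : ℕ}
    (hq : q.Prime) (f g : A →* Multiplicative (ZMod (q ^ t))) (a b : E)
    (hv : IsUnit ((f (π a)).toAdd * (g (π b)).toAdd - (f (π b)).toAdd * (g (π a)).toAdd)) :
    q ^ t ∣ orderOf ⁅a, b⁆ := by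
  have := h.finite
  have : NeZero (q ^ t) := ⟨pow_ne_zero _ hq.ne_zero⟩
  obtain ⟨s, m, hm, ho⟩ := Nat.exists_eq_pow_mul_and_not_dvd (orderOf_pos ⁅a, b⁆).ne' q hq.ne_one
  have hm0 : m ≠ 0 := by rintro rfl; exact hm (dvd_zero q)
  -- Passing to `a ^ m` strips the prime-to-`q` part of the order and only multiplies the form by
  -- the unit `m`.
  have hpow : orderOf ⁅a ^ m, b⁆ = q ^ s := by
    rw [commutatorElement_pow_left h.isStemExtension.ker_le_center,
      orderOf_pow_of_dvd hm0 (ho ▸ Dvd.intro_left _ rfl), ho,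
      Nat.mul_div_cancel _ (Nat.pos_of_ne_zero hm0)]
  have hmu : IsUnit (m : ZMod (q ^ t)) :=
    (ZMod.isUnit_iff_coprime m (q ^ t)).2
      (Nat.Coprime.pow_right t ((Nat.Prime.coprime_iff_not_dvd hq).2 hm).symm)
  have hle := h.le_orderOf_commutatorElement f g (a ^ m) b (by
    have := hmu.mul hv
    rw [mul_sub] at this
    simp only [map_pow, toAdd_pow, nsmul_eq_mul]
    convert this using 1
    ring)
  rw [hpow] at hle
  rw [ho]
  exact (pow_dvd_pow q ((Nat.pow_le_pow_iff_right hq.one_lt).1 hle)).trans (Dvd.intro _ rfl)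

end Detection

/-! ### Connectivity of the reduced graph and the exponent of the central quotient. -/

section Graph

variable {E A : Type*} [Group E] [CommGroup A] {π : E →* A}

theorem IsStemExtension.deepCommutingGraph_adj (h : IsStemExtension π) {a b : E} :
    (deepCommutingGraph π).Adj (π a) (π b) ↔ π a ≠ π b ∧ Commute a b := by
  refine and_congr_right fun _ => ⟨fun H => H a b rfl rfl, fun H c d hc hd => ?_⟩
  rw [← commutatorElement_eq_one_iff_commute] at H ⊢
  rw [h.commutatorElement_eq hc hd, H]

theorem IsStemExtension.commute_of_map_eq (h : IsStemExtension π) {a b : E} (hab : π a = π b) :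
    Commute a b := by
  rw [← commutatorElement_eq_one_iff_commute, h.commutatorElement_eq hab rfl]
  exact commutatorElement_self b

theorem IsStemExtension.mem_universalVerts (h : IsStemExtension π) {a : E} :
    π a ∈ (deepCommutingGraph π).universalVerts ↔ a ∈ Subgroup.center E := by
  rw [Subgroup.mem_center_iff]
  constructor
  · intro H b
    by_cases hab : π a = π b
    · exact (h.commute_of_map_eq hab).symm
    · exact (h.deepCommutingGraph_adj.1 (H hab)).2.symm
  · intro H y hy
    obtain ⟨b, rfl⟩ := h.surjective y
    exact h.deepCommutingGraph_adj.2 ⟨hy, (H b).symm⟩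

/-- The vertex of the reduced graph below a non-central element of the cover. -/
def IsStemExtension.vertex (h : IsStemExtension π) (a : E) (ha : a ∉ Subgroup.center E) :
    ↥((deepCommutingGraph π).universalVertsᶜ) :=
  ⟨π a, fun H => ha (h.mem_universalVerts.1 H)⟩

theorem IsStemExtension.exists_vertex (h : IsStemExtension π)
    (x : ↥((deepCommutingGraph π).universalVertsᶜ)) : ∃ a ha, h.vertex a ha = x := by
  obtain ⟨x, hx⟩ := x
  obtain ⟨a, rfl⟩ := h.surjective x
  exact ⟨a, fun H => hx (h.mem_universalVerts.2 H), rfl⟩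

theorem IsStemExtension.reachable_of_commute (h : IsStemExtension π) {a b : E}
    (ha : a ∉ Subgroup.center E) (hb : b ∉ Subgroup.center E) (hab : Commute a b) :
    (reducedGraph (deepCommutingGraph π)).Reachable (h.vertex a ha) (h.vertex b hb) := by
  by_cases e : π a = π b
  · have : h.vertex a ha = h.vertex b hb := Subtype.ext e
    rw [this]
  · exact SimpleGraph.Adj.reachable (h.deepCommutingGraph_adj.2 ⟨e, hab⟩)

/-- If no prime exponent kills `E / Z(E)`, the reduced deep commuting graph is connected. -/
theorem IsStemExtension.reducedGraph_connected [Finite E] (h : IsStemExtension π)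
    (hne : ∃ a : E, a ∉ Subgroup.center E)
    (hp : ∀ p : ℕ, p.Prime → ∃ a : E, a ^ p ∉ Subgroup.center E) :
    (reducedGraph (deepCommutingGraph π)).Connected := by
  have : Finite A := Finite.of_surjective π h.surjective
  have hπ := h.ker_le_center
  -- `A ⧸ Z` is a commutative model of `E / Z(E)`, so some element has order equal to the exponent.
  let Z : Subgroup A := (Subgroup.center E).map π
  have hZ : ∀ a : E, (QuotientGroup.mk (π a) : A ⧸ Z) = 1 ↔ a ∈ Subgroup.center E := by
    intro a
    rw [QuotientGroup.eq_one_iff]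
    constructor
    · rintro ⟨z, hz, hza⟩
      have : z⁻¹ * a ∈ Subgroup.center E := hπ (by simp [MonoidHom.mem_ker, hza])
      simpa using mul_mem hz this
    · exact fun H => ⟨a, H, rfl⟩
  let φ : E →* A ⧸ Z := (QuotientGroup.mk' Z).comp π
  have hφ : ∀ a : E, φ a = 1 ↔ a ∈ Subgroup.center E := hZ
  have hφs : Function.Surjective φ := (QuotientGroup.mk'_surjective Z).comp h.surjective
  obtain ⟨γ, hγ⟩ := Monoid.exists_orderOf_eq_exponent
    (Monoid.ExponentExists.of_finite (G := A ⧸ Z))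
  obtain ⟨g, rfl⟩ := hφs γ
  set e := Monoid.exponent (A ⧸ Z) with he
  have he0 : e ≠ 0 := Monoid.exponent_ne_zero_of_finite
  have hprime : ¬ e.Prime := fun H => by
    obtain ⟨a, ha⟩ := hp e H
    exact ha ((hφ _).1 (by rw [map_pow, he, Monoid.pow_exponent_eq_one]))
  have hw : ∀ q : ℕ, q.Prime → q ∣ e → g ^ (e / q) ∉ Subgroup.center E := by
    intro q hq hqe H
    rw [← hφ, map_pow] at H
    have := Nat.le_of_dvd (Nat.div_pos (Nat.le_of_dvd (Nat.pos_of_ne_zero he0) hqe) hq.pos)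
      (hγ ▸ orderOf_dvd_of_pow_eq_one H)
    exact absurd this (not_le.2 (Nat.div_lt_self (Nat.pos_of_ne_zero he0) hq.one_lt))
  have hstep : ∀ (a : E) (ha : a ∉ Subgroup.center E), ∃ q, ∃ (hq : q.Prime) (hqe : q ∣ e),
      (reducedGraph (deepCommutingGraph π)).Reachable (h.vertex a ha)
        (h.vertex _ (hw q hq hqe)) := by
    intro a ha
    have ho : orderOf (φ a) ≠ 1 := fun H => ha ((hφ a).1 (orderOf_eq_one_iff.1 H))
    obtain ⟨p, hpp, m, hm⟩ := Nat.exists_prime_and_dvd ho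
    have hoe : orderOf (φ a) ∣ e := Monoid.order_dvd_exponent _
    have ho0 : 0 < orderOf (φ a) := orderOf_pos _
    have hm0 : 0 < m := Nat.pos_of_ne_zero (by rintro rfl; omega)
    have ha' : a ^ m ∉ Subgroup.center E := fun H => by
      rw [← hφ, map_pow] at H
      have := Nat.le_of_dvd hm0 (orderOf_dvd_of_pow_eq_one H)
      rw [hm] at this
      nlinarith [hpp.two_le]
    have hap : (a ^ m) ^ p ∈ Subgroup.center E := by
      rw [← hφ, ← pow_mul, mul_comm, ← hm, map_pow, pow_orderOf_eq_one]
    obtain ⟨d, hd⟩ : p ∣ e := (Dvd.intro _ hm.symm).trans hoe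
    have hd1 : d ≠ 1 := by rintro rfl; exact hprime (by rwa [hd, mul_one])
    obtain ⟨q, hq, r, hr⟩ := Nat.exists_prime_and_dvd hd1
    have hqe : q ∣ e := ⟨p * r, by rw [hd, hr]; ring⟩
    -- The path is `a`, `a ^ m`, `g ^ (e / q)`. Since `q` divides `e / p`, the exponent `e / q` is
    -- still a multiple of `p`, and moving that `p` across the pairing gives the central element `(a
    -- ^ m) ^ p`.
    refine ⟨q, hq, hqe, (h.reachable_of_commute ha ha' (Commute.self_pow a m)).trans
      (h.reachable_of_commute ha' _ ?_)⟩
    have hdiv : e / q = p * r := by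
      rw [hd, hr, show p * (q * r) = q * (p * r) by ring, Nat.mul_div_cancel_left _ hq.pos]
    rw [hdiv, ← commutatorElement_eq_one_iff_commute, commutatorElement_pow_right hπ, pow_mul,
      ← commutatorElement_pow_left hπ,
      commutatorElement_eq_one_iff_commute.2 (Subgroup.mem_center_iff.1 hap g).symm, one_pow]
  have : Nonempty ↥((deepCommutingGraph π).universalVertsᶜ) := by
    obtain ⟨a, ha⟩ := hne
    exact ⟨h.vertex a ha⟩
  refine ⟨fun x y => ?_⟩
  obtain ⟨a, ha, rfl⟩ := h.exists_vertex x
  obtain ⟨b, hb, rfl⟩ := h.exists_vertex y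
  obtain ⟨q, hq, hqe, h1⟩ := hstep a ha
  obtain ⟨q', hq', hqe', h2⟩ := hstep b hb
  exact h1.trans ((h.reachable_of_commute _ _ ((Commute.refl g).pow_pow _ _)).trans h2.symm)

theorem exists_addMonoidHom_zmod_ne_zero (p : ℕ) [Fact p.Prime] {V : Type*} [AddCommGroup V]
    (hV : ∀ v : V, p • v = 0) {x : V} (hx : x ≠ 0) : ∃ f : V →+ ZMod p, f x ≠ 0 := by
  have key : ∀ [Module (ZMod p) V], ∃ f : V →+ ZMod p, f x ≠ 0 := by
    intro _
    by_contra! H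
    exact hx ((Module.forall_dual_apply_eq_zero_iff (ZMod p) x).1 fun φ => H φ.toAddMonoidHom)
  exact @key (AddCommGroup.zmodModule hV)

/-- Homomorphisms to `ZMod p` separate the points of `A` modulo `p`-th powers. -/
theorem exists_hom_ne_one_of_not_pow (p : ℕ) [Fact p.Prime] {x : A} (hx : ∀ y : A, y ^ p ≠ x) :
    ∃ f : A →* Multiplicative (ZMod p), f x ≠ 1 := by
  let H : AddSubgroup (Additive A) := (nsmulAddMonoidHom (α := Additive A) p).range
  have h0 : (QuotientAddGroup.mk' H) (Additive.ofMul x) ≠ 0 := by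
    rw [Ne, QuotientAddGroup.mk'_apply, QuotientAddGroup.eq_zero_iff]
    rintro ⟨y, hy⟩
    exact hx y.toMul hy
  obtain ⟨φ, hφ⟩ := exists_addMonoidHom_zmod_ne_zero p (fun v => by
    obtain ⟨v, rfl⟩ := QuotientAddGroup.mk'_surjective H v
    rw [← map_nsmul, QuotientAddGroup.mk'_apply, QuotientAddGroup.eq_zero_iff]
    exact ⟨v, rfl⟩) h0
  exact ⟨AddMonoidHom.toMultiplicativeRight (φ.comp (QuotientAddGroup.mk' H)), fun H' => hφ H'⟩

/-- If `E / Z(E)` has prime exponent, commuting is transitive outside the centre of a Schur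
cover. -/
theorem IsSchurCover.commute_trans (h : IsSchurCover π) {p : ℕ} (hp : p.Prime)
    (hc : ∀ a : E, a ^ p ∈ Subgroup.center E) {a b c : E} (hb : b ∉ Subgroup.center E)
    (hab : Commute a b) (hbc : Commute b c) : Commute a c := by
  have : Fact p.Prime := ⟨hp⟩
  have hker := h.isStemExtension.ker_le_center
  have hpow : ∀ (x : E) (y : A), y ^ p = π x → x ∈ Subgroup.center E := by
    intro x y hy
    obtain ⟨d, rfl⟩ := h.isStemExtension.surjective y
    rw [← map_pow] at hy
    have : (d ^ p)⁻¹ * x ∈ Subgroup.center E := hker (by simp [MonoidHom.mem_ker, hy])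
    simpa using mul_mem (hc d) this
  -- As `a` and `b` commute, every alternating form `f ∧ g` must vanish on them, so their images
  -- modulo `p`-th powers are proportional.
  have hfg : ∀ f g : A →* Multiplicative (ZMod p),
      (f (π a)).toAdd * (g (π b)).toAdd = (f (π b)).toAdd * (g (π a)).toAdd := by
    intro f g
    by_contra H
    have := h.le_orderOf_commutatorElement f g a b (isUnit_iff_ne_zero.2 (sub_ne_zero.2 H))
    rw [commutatorElement_eq_one_iff_commute.2 hab, orderOf_one] at this
    exact absurd hp.one_lt (not_lt.2 this)
  obtain ⟨f, hf⟩ := exists_hom_ne_one_of_not_pow p (x := π b) fun y hy => hb (hpow b y hy)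
  have hf' : (f (π b)).toAdd ≠ 0 := hf
  -- The proportionality factor: `a` equals `b ^ m` up to the centre.
  set m : ℕ := ((f (π a)).toAdd * (f (π b)).toAdd⁻¹).val with hm
  have hz : a * (b ^ m)⁻¹ ∈ Subgroup.center E := by
    by_contra H
    obtain ⟨g, hg⟩ := exists_hom_ne_one_of_not_pow p (x := π (a * (b ^ m)⁻¹))
      fun y hy => H (hpow _ y hy)
    apply hg
    apply Multiplicative.toAdd.injective
    simp only [map_mul, map_inv, map_pow, toAdd_mul, toAdd_inv, toAdd_pow, nsmul_eq_mul, toAdd_one]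
    rw [hm, ZMod.natCast_zmod_val]
    have := hfg f g
    field_simp
    linear_combination -this
  have h1 : Commute (a * (b ^ m)⁻¹) c := (Subgroup.mem_center_iff.1 hz c).symm
  simpa using h1.mul_left (hbc.pow_left m)

/-- The reduced deep commuting graph of a non-commutative Schur cover is disconnected exactly when
the central quotient of the cover has prime exponent. -/
theorem IsSchurCover.not_connected_iff (h : IsSchurCover π)
    (hne : ∃ a : E, a ∉ Subgroup.center E) :
    ¬ (reducedGraph (deepCommutingGraph π)).Connected ↔
      ∃ p : ℕ, p.Prime ∧ ∀ a : E, a ^ p ∈ Subgroup.center E := by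
  have := h.finite
  have hs := h.isStemExtension
  constructor
  · intro H
    by_contra! H'
    exact H (hs.reducedGraph_connected hne H')
  · rintro ⟨p, hp, hc⟩ H
    have key : ∀ x y, (reducedGraph (deepCommutingGraph π)).Reachable x y →
        ∀ a b ha hb, hs.vertex a ha = x → hs.vertex b hb = y → Commute a b := by
      rintro x y ⟨w⟩
      induction w with
      | nil =>
        rintro a b ha hb hx hy
        exact hs.commute_of_map_eq (congrArg Subtype.val (hx.trans hy.symm))
      | @cons u v w huv _ ih =>
        rintro a b ha hb rfl hy
        obtain ⟨c, hcn, rfl⟩ := hs.exists_vertex v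
        exact h.commute_trans hp hc hcn (hs.deepCommutingGraph_adj.1 huv).2
          (ih c b hcn hb rfl hy)
    obtain ⟨a, ha⟩ := hne
    refine ha (Subgroup.mem_center_iff.2 fun b => ?_)
    by_cases hb : b ∈ Subgroup.center E
    · exact (Subgroup.mem_center_iff.1 hb a).symm
    · exact (key _ _ (H.preconnected _ _) b a hb ha rfl rfl)

end Graph

/-! ### From the exponent of the central quotient to cyclic decompositions. -/

section Decomposition

variable {E A : Type*} [Group E] [CommGroup A] {π : E →* A}

theorem isCyclic_pi_zmod {ι : Type*} [Finite ι] (n : ι → ℕ)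
    (hn : Pairwise (Function.onFun Nat.Coprime n)) :
    IsCyclic ((i : ι) → Multiplicative (ZMod (n i))) := by
  cases nonempty_fintype ι
  exact isCyclic_of_surjective ((ZMod.prodEquivPi n hn).toAddEquiv.toMultiplicative.trans
    (MulEquiv.piMultiplicative _))
    (MulEquiv.surjective _)

theorem exists_mulEquiv_pi_zmod_prime_pow (A : Type*) [CommGroup A] [Finite A] :
    ∃ (ι : Type) (_ : Fintype ι) (p : ι → ℕ) (_ : ∀ i, (p i).Prime) (e : ι → ℕ),
      Nonempty (A ≃* ((i : ι) → Multiplicative (ZMod (p i ^ e i)))) := by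
  obtain ⟨ι, inst, p, hp, e, ⟨h⟩⟩ := AddCommGroup.equiv_directSum_zmod_of_finite (Additive A)
  exact ⟨ι, inst, p, hp, e, ⟨MulEquiv.toAdditive.symm <| h.trans <|
    (DirectSum.addEquivProd _).trans (MulEquiv.piMultiplicative _).toAdditiveRight⟩⟩

/-- Two cyclic factors of order divisible by `q ^ t` yield a commutator in the Schur cover of order
divisible by `q ^ t`. -/
theorem IsSchurCover.exists_pow_dvd_orderOf (h : IsSchurCover π) {ι : Type*} {n : ι → ℕ}
    (φ : A ≃* ((i : ι) → Multiplicative (ZMod (n i)))) {i j : ι} (hij : i ≠ j) {q t : ℕ}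
    (hq : q.Prime) (hi : q ^ t ∣ n i) (hj : q ^ t ∣ n j) :
    ∃ a b : E, q ^ t ∣ orderOf ⁅a, b⁆ := by
  classical
  -- Coordinates reduced modulo `q ^ t`; on lifts of the standard generators `x i`, `x j` the form
  -- `F i ∧ F j` takes the value 1.
  let F : ∀ k : ι, q ^ t ∣ n k → (A →* Multiplicative (ZMod (q ^ t))) := fun k hk =>
    (AddMonoidHom.toMultiplicative (ZMod.castHom hk (ZMod (q ^ t))).toAddMonoidHom).comp
      ((Pi.evalMonoidHom _ k).comp φ.toMonoidHom)
  let x : ι → A := fun k => φ.symm (Pi.mulSingle k (Multiplicative.ofAdd 1))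
  have hF1 : ∀ k hk, (F k hk (x k)).toAdd = 1 := fun k hk => by
    change ZMod.castHom hk (ZMod (q ^ t)) (φ (x k) k).toAdd = 1
    rw [MulEquiv.apply_symm_apply, Pi.mulSingle_eq_same]
    exact map_one _
  have hF0 : ∀ k hk l, k ≠ l → (F k hk (x l)).toAdd = 0 := fun k hk l hkl => by
    change ZMod.castHom hk (ZMod (q ^ t)) (φ (x l) k).toAdd = 0
    simp [x, Pi.mulSingle_eq_of_ne hkl]
  obtain ⟨a, ha⟩ := h.isStemExtension.surjective (x i)
  obtain ⟨b, hb⟩ := h.isStemExtension.surjective (x j)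
  refine ⟨a, b, h.pow_dvd_orderOf_commutatorElement hq (F i hi) (F j hj) a b ?_⟩
  rw [ha, hb, hF1, hF1, hF0 i hi j hij]
  simp

/-- A Schur cover of a non-cyclic abelian group is not commutative. -/
theorem IsSchurCover.exists_notMem_center (h : IsSchurCover π) [Finite A] (hA : ¬ IsCyclic A) :
    ∃ a : E, a ∉ Subgroup.center E := by
  obtain ⟨ι, _, n, -, ⟨φ⟩⟩ := CommGroup.equiv_prod_multiplicative_zmod_of_finite A
  have hn : ¬ Pairwise (Function.onFun Nat.Coprime n) := fun H =>
    hA (φ.isCyclic.2 (isCyclic_pi_zmod n H))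
  simp only [Pairwise, Function.onFun] at hn
  push Not at hn
  obtain ⟨i, j, hij, hc⟩ := hn
  obtain ⟨q, hq, hi, hj⟩ := Nat.Prime.not_coprime_iff_dvd.1 hc
  obtain ⟨a, b, hab⟩ := h.exists_pow_dvd_orderOf φ hij hq (t := 1) (by simpa) (by simpa)
  refine ⟨b, fun hb => ?_⟩
  have : ⁅a, b⁆ = 1 := commutatorElement_eq_one_iff_commute.2 (Subgroup.mem_center_iff.1 hb a)
  rw [this, orderOf_one, pow_one] at hab
  exact hq.one_lt.not_ge (Nat.le_of_dvd one_pos hab)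

theorem IsStemExtension.orderOf_commutatorElement_dvd (h : IsStemExtension π) {p : ℕ}
    (hc : ∀ a : E, a ^ p ∈ Subgroup.center E) (a b : E) : orderOf ⁅a, b⁆ ∣ p := by
  refine orderOf_dvd_of_pow_eq_one ?_
  rw [← commutatorElement_pow_left h.ker_le_center]
  exact commutatorElement_eq_one_iff_commute.2 (Subgroup.mem_center_iff.1 (hc a) b).symm

/-- If `A` is generated by one element together with elements killed by `p`, then `p` kills the
central quotient of every stem extension of `A`. -/
theorem IsStemExtension.pow_mem_center (h : IsStemExtension π) {p : ℕ} {g : A}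
    (hg : ∀ x : A, ∃ (m : ℕ) (y : A), y ^ p = 1 ∧ x = g ^ m * y) (a : E) :
    a ^ p ∈ Subgroup.center E := by
  have hk := h.ker_le_center
  obtain ⟨c, rfl⟩ := h.surjective g
  have hp : ∀ b : E, ∃ m : ℕ, π (b ^ p) = π (c ^ (m * p)) := fun b => by
    obtain ⟨m, y, hy, hb⟩ := hg (π b)
    exact ⟨m, by rw [map_pow, hb, mul_pow, hy, mul_one, map_pow, pow_mul]⟩
  refine Subgroup.mem_center_iff.2 fun b => ?_
  obtain ⟨m, hm⟩ := hp a
  obtain ⟨k, hk'⟩ := hp b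
  -- Replace `a ^ p` by `c ^ (m * p)` and move `p` to the other side: `b ^ p` also lies over a power
  -- of `c`, so the pairing vanishes.
  suffices ⁅a ^ p, b⁆ = 1 from (commutatorElement_eq_one_iff_commute.1 this).symm
  rw [h.commutatorElement_eq hm rfl, commutatorElement_pow_left hk, mul_comm, pow_mul,
    ← commutatorElement_pow_right hk, h.commutatorElement_eq rfl hk',
    commutatorElement_eq_one_iff_commute.2 (Commute.self_pow c _), one_pow]

theorem IsElementaryAbelian.pow_eq_one {p : ℕ} {K : Type*} [CommGroup K]
    (hK : IsElementaryAbelian p K) (x : K) : x ^ p = 1 := by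
  by_cases hx : x = 1
  · rw [hx, one_pow]
  · rw [← hK x hx, pow_orderOf_eq_one]

theorem exists_generator_of_mulEquiv_prod [Finite A] {p : ℕ} {C K : Type*} [CommGroup C]
    [CommGroup K] [IsCyclic C] (hK : IsElementaryAbelian p K) (φ : A ≃* C × K) :
    ∃ g : A, ∀ x : A, ∃ (m : ℕ) (y : A), y ^ p = 1 ∧ x = g ^ m * y := by
  have : Finite (C × K) := Finite.of_equiv _ φ.toEquiv
  have : Finite C := Finite.of_surjective _ (Prod.fst_surjective (α := C) (β := K))
  obtain ⟨c, hc⟩ := IsCyclic.exists_monoid_generator (α := C)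
  refine ⟨φ.symm (c, 1), fun x => ?_⟩
  obtain ⟨m, hm⟩ := hc (φ x).1
  refine ⟨m, φ.symm (1, (φ x).2), ?_, ?_⟩
  · rw [← map_pow, Prod.pow_mk, hK.pow_eq_one, one_pow]
    exact map_one _
  · rw [← map_pow, ← map_mul, MulEquiv.eq_symm_apply]
    ext <;> simp [← hm]

theorem HasPType.exists_generator {p k : ℕ} (hp : p.Prime) (hk : 2 ≤ k) {r : Fin k → ℕ}
    (h : HasPType p A r) (hr : r ⟨1, hk⟩ = 1) :
    ∃ g : A, ∀ x : A, ∃ (m : ℕ) (y : A), y ^ p = 1 ∧ x = g ^ m * y := by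
  obtain ⟨φ⟩ := h.iso
  let o : Fin k := ⟨0, by omega⟩
  refine ⟨φ.symm (Pi.mulSingle o (Multiplicative.ofAdd 1)), fun x => ?_⟩
  have : NeZero (p ^ r o) := ⟨pow_ne_zero _ hp.ne_zero⟩
  set g := φ.symm (Pi.mulSingle o (Multiplicative.ofAdd 1)) with hg
  let m : ℕ := (φ x o).toAdd.val
  refine ⟨m, (g ^ m)⁻¹ * x, φ.injective ?_, by simp⟩
  funext i
  apply Multiplicative.toAdd.injective
  by_cases hi : i = o
  · subst hi
    simp [hg, m]
  · have hi1 : r i ≤ 1 := by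
      rw [← hr]
      refine h.antitone (Fin.mk_le_of_le_val ?_)
      exact Nat.one_le_iff_ne_zero.2 fun H => hi (Fin.ext H)
    have hz : ((p : ℕ) : ZMod (p ^ r i)) = 0 := by
      rw [ZMod.natCast_eq_zero_iff]
      simpa using pow_dvd_pow p hi1
    simp [hz]

/-- If the central quotient of a Schur cover of a non-cyclic abelian group `A` has prime exponent
`p`, then `A` is the product of a cyclic group and an elementary abelian `p`-group. -/
theorem IsSchurCover.exists_mulEquiv_prod (h : IsSchurCover π) [Finite A] (hA : ¬ IsCyclic A)
    {p : ℕ} (hp : p.Prime) (hc : ∀ a : E, a ^ p ∈ Subgroup.center E) :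
    ∃ (C K : Type) (_ : CommGroup C) (_ : CommGroup K),
      IsCyclic C ∧ IsElementaryAbelian p K ∧ Nonempty (A ≃* C × K) := by
  classical
  obtain ⟨ι, _, q, hq, e, ⟨φ⟩⟩ := exists_mulEquiv_pi_zmod_prime_pow A
  have hmin : ∀ i j, i ≠ j → q i = q j → q i ^ min (e i) (e j) ∣ p := by
    intro i j hij hqq
    obtain ⟨a, b, hab⟩ := h.exists_pow_dvd_orderOf φ hij (hq i) (t := min (e i) (e j))
      (pow_dvd_pow _ (min_le_left _ _)) (hqq ▸ pow_dvd_pow _ (min_le_right _ _))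
    exact hab.trans (h.isStemExtension.orderOf_commutatorElement_dvd hc a b)
  have hcop : ∀ i j, i ≠ j → q i ≠ p → Nat.Coprime (q i ^ e i) (q j ^ e j) := by
    intro i j hij hqp
    by_cases hqq : q i = q j
    · have h1 := hmin i j hij hqq
      have h2 : min (e i) (e j) = 0 := by
        by_contra H
        exact hqp ((Nat.prime_dvd_prime_iff_eq (hq i) hp).1 ((dvd_pow_self _ H).trans h1))
      rcases Nat.min_eq_zero_iff.1 h2 with h3 | h3 <;> simp [h3]
    · exact Nat.Coprime.pow _ _ ((Nat.coprime_primes (hq i) (hq j)).2 hqq)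
  have hne : (Finset.univ.filter fun i => q i = p).Nonempty := by
    by_contra H
    rw [Finset.not_nonempty_iff_eq_empty, Finset.filter_eq_empty_iff] at H
    exact hA (φ.isCyclic.2 (isCyclic_pi_zmod _ fun i j hij => hcop i j hij (H (Finset.mem_univ i))))
  obtain ⟨o, ho, hmax⟩ := Finset.exists_max_image _ e hne
  simp only [Finset.mem_filter, Finset.mem_univ, true_and] at ho hmax
  have hle : ∀ i, q i = p → i ≠ o → e i ≤ 1 := by
    intro i hi hio
    have h1 := hmin i o hio (hi.trans ho.symm)
    rw [min_eq_left (hmax i hi), hi] at h1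
    nth_rewrite 2 [← pow_one p] at h1
    exact (Nat.pow_dvd_pow_iff_le_right hp.one_lt).1 h1
  -- The cyclic part takes the largest `p`-factor `o` and all factors at other primes, which are
  -- pairwise coprime; the remaining `p`-factors have exponent at most 1.
  let S : ι → Prop := fun i => ¬ (q i = p ∧ i ≠ o)
  let M : ι → Type := fun i => Multiplicative (ZMod (q i ^ e i))
  refine ⟨(i : {i // S i}) → M i, (i : {i // ¬ S i}) → M i, inferInstance, inferInstance, ?_, ?_,
    ⟨φ.trans ⟨Equiv.piEquivPiSubtypeProd S M, fun _ _ => rfl⟩⟩⟩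
  · refine isCyclic_pi_zmod (fun i : {i // S i} => q i ^ e i) fun i j hij => ?_
    have hij' : (i : ι) ≠ j := fun H => hij (Subtype.ext H)
    by_cases hi : q i = p
    · by_cases hj : q j = p
      · have h1 : (i : ι) = o := by
          by_contra H
          exact i.2 ⟨hi, H⟩
        have h2 : (j : ι) = o := by
          by_contra H
          exact j.2 ⟨hj, H⟩
        exact absurd (h1.trans h2.symm) hij'
      · exact (hcop j i hij'.symm hj).symm
    · exact hcop i j hij' hi
  · intro x hx
    have : Fact p.Prime := ⟨hp⟩
    refine orderOf_eq_prime ?_ hx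
    funext i
    apply Multiplicative.toAdd.injective
    have hi : q i = p ∧ (i : ι) ≠ o := not_not.1 i.2
    have hz : ((p : ℕ) : ZMod (q i ^ e i)) = 0 := by
      rw [ZMod.natCast_eq_zero_iff]
      exact (pow_dvd_pow (q i) (hle i hi.1 hi.2)).trans (by rw [pow_one, hi.1])
    change p • (x i).toAdd = 0
    rw [nsmul_eq_mul]
    exact (congrArg (· * _) hz).trans (zero_mul _)

/-- The type of a non-cyclic finite abelian `p`-group. -/
theorem exists_hasPType [Finite A] {p : ℕ} (hp : p.Prime) (hpA : IsPGroup p A)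
    (hA : ¬ IsCyclic A) : ∃ (k : ℕ) (r : Fin k → ℕ), 2 ≤ k ∧ HasPType p A r := by
  classical
  obtain ⟨ι, _, n, hn, ⟨φ⟩⟩ := CommGroup.equiv_prod_multiplicative_zmod_of_finite A
  have hpow : ∀ i, ∃ r, n i = p ^ r := by
    intro i
    obtain ⟨k, hk⟩ := hpA (φ.symm (Pi.mulSingle i (Multiplicative.ofAdd 1)))
    rw [← map_pow, MulEquiv.map_eq_one_iff] at hk
    have h1 := congrArg Multiplicative.toAdd (congrFun hk i)
    simp only [Pi.pow_apply, Pi.mulSingle_eq_same, toAdd_pow, toAdd_ofAdd, nsmul_eq_mul, mul_one,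
      Pi.one_apply, toAdd_one] at h1
    rw [ZMod.natCast_eq_zero_iff] at h1
    obtain ⟨r, -, hr⟩ := (Nat.dvd_prime_pow hp).1 h1
    exact ⟨r, hr⟩
  choose s hs using hpow
  obtain rfl : n = fun i => p ^ s i := funext hs
  let σ₀ : Fin (Fintype.card ι) ≃ ι := (Fintype.equivFin ι).symm
  let σ : Fin (Fintype.card ι) ≃ ι :=
    (Tuple.sort fun i => OrderDual.toDual (s (σ₀ i))).trans σ₀
  refine ⟨Fintype.card ι, fun i => s (σ i), ?_, ?_, ?_, ?_⟩
  · by_contra H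
    have : Subsingleton ι := Fintype.card_le_one_iff_subsingleton.1 (by omega)
    exact hA (φ.isCyclic.2 (isCyclic_pi_zmod _ fun i j hij => absurd (Subsingleton.elim i j) hij))
  · exact fun i j hij => Tuple.monotone_sort (fun i => OrderDual.toDual (s (σ₀ i))) hij
  · intro i
    refine Nat.one_le_iff_ne_zero.2 fun H => ?_
    have := hn (σ i)
    simp [H] at this
  · exact ⟨φ.trans ⟨Equiv.piCongrLeft' (fun i => Multiplicative (ZMod (p ^ s i))) σ.symm,
      fun _ _ => rfl⟩⟩

end Decomposition

theorem mainTheorem8 :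
    -- finite non-cyclic abelian `p`-groups
    (∀ (p : ℕ) (G : Type*) [CommGroup G] [Finite G], p.Prime → IsPGroup p G → ¬ IsCyclic G →
      (∃ (k : ℕ) (r : Fin k → ℕ), 2 ≤ k ∧ HasPType p G r) ∧
      (∃ (E : Type) (_ : Group E) (π : E →* G), IsSchurCover π) ∧
      ∀ (k : ℕ) (hk : 2 ≤ k) (r : Fin k → ℕ), HasPType p G r →
        ∀ (E : Type*) [Group E] (π : E →* G), IsSchurCover π →
          (¬ (reducedGraph (deepCommutingGraph π)).Connected ↔ r ⟨1, hk⟩ = 1)) ∧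
    -- finite non-cyclic abelian groups
    (∀ (A : Type*) [CommGroup A] [Finite A], ¬ IsCyclic A →
      (∃ (E : Type) (_ : Group E) (π : E →* A), IsSchurCover π) ∧
      ∀ (E : Type*) [Group E] (π : E →* A), IsSchurCover π →
        (¬ (reducedGraph (deepCommutingGraph π)).Connected ↔
          ∃ (p : ℕ) (C K : Type) (_ : CommGroup C) (_ : CommGroup K),
            p.Prime ∧ IsCyclic C ∧ IsElementaryAbelian p K ∧ Nonempty (A ≃* C × K))) := by
  refine ⟨fun p G _ _ hp hpG hG => ⟨exists_hasPType hp hpG hG, exists_isSchurCover G, ?_⟩,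
    fun A _ _ hA => ⟨exists_isSchurCover A, ?_⟩⟩
  · intro k hk r hr E _ π h
    rw [h.not_connected_iff (h.exists_notMem_center hG)]
    constructor
    · rintro ⟨q, hq, hc⟩
      obtain ⟨φ⟩ := hr.iso
      have h01 : (⟨0, by omega⟩ : Fin k) ≤ ⟨1, hk⟩ := Fin.mk_le_mk.2 zero_le_one
      obtain ⟨a, b, hab⟩ := h.exists_pow_dvd_orderOf φ (i := ⟨0, by omega⟩) (j := ⟨1, hk⟩)
        (by simp) hp (t := r ⟨1, hk⟩) (pow_dvd_pow p (hr.antitone h01)) dvd_rfl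
      have hdvd := hab.trans (h.isStemExtension.orderOf_commutatorElement_dvd hc a b)
      have hr1 := hr.pos ⟨1, hk⟩
      -- The prime exponent `q` is not known in advance to be `p`; a commutator of order divisible
      -- by `p ^ r₂`, with `r₂ ≥ 1`, forces it.
      have hqp : p = q := (Nat.prime_dvd_prime_iff_eq hp hq).1
        ((dvd_pow_self p (by omega)).trans hdvd)
      subst hqp
      nth_rewrite 2 [← pow_one p] at hdvd
      have := (Nat.pow_dvd_pow_iff_le_right hp.one_lt).1 hdvd
      omega
    · intro hr1
      obtain ⟨g, hg⟩ := hr.exists_generator hp hk hr1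
      exact ⟨p, hp, h.isStemExtension.pow_mem_center hg⟩
  · intro E _ π h
    rw [h.not_connected_iff (h.exists_notMem_center hA)]
    constructor
    · rintro ⟨p, hp, hc⟩
      obtain ⟨C, K, iC, iK, hC, hK, hφ⟩ := h.exists_mulEquiv_prod hA hp hc
      exact ⟨p, C, K, iC, iK, hp, hC, hK, hφ⟩
    · rintro ⟨p, C, K, _, _, hp, hC, hK, ⟨φ⟩⟩
      obtain ⟨g, hg⟩ := exists_generator_of_mulEquiv_prod hK φ
      exact ⟨p, hp, h.isStemExtension.pow_mem_center hg⟩
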